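/- Let $r\ge 3$ and $2\le t\le r$ be integers. An $r$-graph is an $r$-uniform hypergraph, and an $r$-graph is $F$-free if it contains no (not necessarily induced) copy of $F$. For $r$-graphs $F,G$ and an integer $n\ge 1$, let $f_{F,G}(n)$ be the maximum integer $m$ such that every $n$-vertex $G$-free $r$-graph has an $F$-free induced subgraph on exactly $m$ vertices. For $0\le s\le r+1$, let $H^r_s$ be the $r$-graph, unique up to isomorphism, with $r+1$ vertices and $s$ edges. Then there exists a constant $c$, depending only on $r$ and $t$, such that, for all large enough $n$, $$ f_{H^r_t,\,H^r_{t+1}}(n)\le c(\log n)^{\frac{1}{r-2}}. $$ -/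

import Mathlib

namespace Hypergraph

/-- `H` is an `r`-graph, i.e. every edge has exactly `r` vertices. -/
def IsUniform {α : Type*} (H : Hypergraph α) (r : ℕ) : Prop :=
  ∀ e ∈ H.edgeSet, e.encard = r

/-- The subgraph of `H` induced on `W`: its edges are all the edges of `H` contained in `W`. -/
def induce {α : Type*} (H : Hypergraph α) (W : Set α) : Hypergraph α where
  vertexSet := H.vertexSet ∩ W
  edgeSet := {e | e ∈ H.edgeSet ∧ e ⊆ W}
  subset_vertexSet_of_mem_edgeSet' := fun _ he =>
    Set.subset_inter (H.subset_vertexSet_of_mem_edgeSet' he.1) he.2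

/-- `H` contains a (not necessarily induced) copy of `F`: some injection from the vertices of `F`
to the vertices of `H` sends every edge of `F` onto an edge of `H`. -/
def Contains {α β : Type*} (H : Hypergraph α) (F : Hypergraph β) : Prop :=
  ∃ φ : F.vertexSet ↪ H.vertexSet,
    ∀ e ∈ F.edgeSet, {x : α | ∃ v : F.vertexSet, (v : β) ∈ e ∧ (φ v : α) = x} ∈ H.edgeSet

/-- `H` is `F`-free. -/
def IsFree {α β : Type*} (H : Hypergraph α) (F : Hypergraph β) : Prop :=
  ¬ H.Contains F

end Hypergraph

/-- The `m` such that every `n`-vertex `G`-free `r`-graph has an `F`-free induced subgraph on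
`m` vertices. -/
def erdosRogersSet {β γ : Type} (r : ℕ) (F : Hypergraph β) (G : Hypergraph γ) (n : ℕ) : Set ℕ :=
  {m | ∀ (α : Type) (H : Hypergraph α), H.IsUniform r → H.vertexSet.encard = n → H.IsFree G →
    ∃ W ⊆ H.vertexSet, W.encard = m ∧ (H.induce W).IsFree F}

/-- The Erdős–Rogers function `f_{F,G}(n)` for `r`-graphs: the maximum `m` such that every
`n`-vertex `G`-free `r`-graph has an `F`-free induced subgraph on `m` vertices. -/
noncomputable def erdosRogers {β γ : Type} (r : ℕ) (F : Hypergraph β) (G : Hypergraph γ)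
    (n : ℕ) : ℕ :=
  sSup (erdosRogersSet r F G n)

/-- When `F` has a vertex and `G` has an edge, the maximum defining
`f_{F,G}(n)` exists. -/
theorem erdosRogers_isGreatest {β γ : Type} (r : ℕ) (F : Hypergraph β) (G : Hypergraph γ)
    (hF : F.vertexSet.Nonempty) (hG : G.edgeSet.Nonempty) (n : ℕ) :
    IsGreatest (erdosRogersSet r F G n) (erdosRogers r F G n) := by
  have hne : (erdosRogersSet r F G n).Nonempty := by
    refine ⟨0, fun α H _ _ _ => ⟨∅, Set.empty_subset _, by simp, ?_⟩⟩
    rintro ⟨φ, -⟩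
    obtain ⟨v, hv⟩ := hF
    exact (φ ⟨v, hv⟩).2.2
  have hbdd : BddAbove (erdosRogersSet r F G n) := by
    refine ⟨n, fun m hm => ?_⟩
    obtain ⟨W, hW, hc, -⟩ := hm (Fin n) (Hypergraph.trivialOn Set.univ)
      (by intro e he; simp at he) (by simp)
      (by
        rintro ⟨φ, h⟩
        obtain ⟨e, he⟩ := hG
        simpa using h e he)
    have h1 : W.encard ≤ (Set.univ : Set (Fin n)).encard := Set.encard_le_encard (Set.subset_univ W)
    rw [hc] at h1
    simpa using h1
  exact ⟨Nat.sSup_mem hne hbdd, fun m hm => le_csSup hbdd hm⟩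

/-- For `t ≤ r + 1`, the `r`-graph `H^r_t` with `r + 1` vertices and `t` edges: every edge is the
complement of a vertex, and the edges are the complements of the first `t` vertices. -/
def simplexGraph (r t : ℕ) : Hypergraph (Fin (r + 1)) where
  vertexSet := Set.univ
  edgeSet := {e | ∃ i : Fin (r + 1), (i : ℕ) < t ∧ e = {i}ᶜ}
  subset_vertexSet_of_mem_edgeSet' := fun _ _ => Set.subset_univ _

theorem simplexGraph_isUniform (r t : ℕ) : (simplexGraph r t).IsUniform r := by
  rintro e ⟨i, -, rfl⟩
  rw [← Set.Finite.cast_ncard_eq (Set.toFinite _), Set.ncard_compl, Set.ncard_singleton]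
  simp

theorem simplexGraph_encard_vertexSet (r t : ℕ) :
    (simplexGraph r t).vertexSet.encard = (r + 1 : ℕ) := by
  simp [simplexGraph]

theorem simplexGraph_encard_edgeSet (r t : ℕ) (ht : t ≤ r + 1) :
    (simplexGraph r t).edgeSet.encard = t := by
  have h : (simplexGraph r t).edgeSet =
      (fun i : Fin t => ({Fin.castLE ht i}ᶜ : Set (Fin (r + 1)))) '' Set.univ := by
    ext e
    constructor
    · rintro ⟨i, hi, rfl⟩
      exact ⟨⟨i, hi⟩, trivial, rfl⟩
    · rintro ⟨i, -, rfl⟩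
      exact ⟨Fin.castLE ht i, i.2, rfl⟩
  rw [h, Function.Injective.encard_image]
  · simp
  · intro i j hij
    simpa using hij

/-- `H^r_t` is, up to isomorphism, the only `r`-graph with `r + 1` vertices and `t` edges. -/
theorem simplexGraph_unique {α : Type*} (r t : ℕ) (H : Hypergraph α) (hr : H.IsUniform r)
    (hV : H.vertexSet.encard = (r + 1 : ℕ)) (hE : H.edgeSet.encard = t) :
    ∃ φ : Fin (r + 1) → α, Function.Injective φ ∧ (simplexGraph r t).image φ = H := by
  classical
  have hfin : H.vertexSet.Finite := Set.finite_of_encard_eq_coe hV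
  have hVn : Nat.card H.vertexSet = r + 1 := by
    rw [Nat.card_coe_set_eq, Set.ncard, hV]; rfl
  have : Finite H.vertexSet := hfin
  let e0 : Fin (r + 1) ≃ H.vertexSet := (Finite.equivFinOfCardEq hVn).symm
  let c : Fin (r + 1) → Set α := fun i => H.vertexSet \ {(e0 i : α)}
  have hcinj : Function.Injective c := by
    intro i j hij
    by_contra hne
    have h1 : (e0 i : α) ∈ c j := ⟨(e0 i).2, fun h => hne (e0.injective (Subtype.ext h))⟩
    rw [← hij] at h1
    exact h1.2 rfl
  have hEc : ∀ e ∈ H.edgeSet, ∃ i, c i = e := by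
    intro e he
    have hsub := H.subset_vertexSet_of_mem_edgeSet' he
    have h1 : (H.vertexSet \ e).encard = 1 := by
      have h2 := Set.encard_sdiff_add_encard_of_subset hsub
      rw [hr e he, hV, Nat.cast_add, add_comm] at h2
      simpa using h2
    obtain ⟨x, hx⟩ := Set.encard_eq_one.1 h1
    have hxV : x ∈ H.vertexSet := (hx ▸ Set.mem_singleton x : x ∈ H.vertexSet \ e).1
    refine ⟨e0.symm ⟨x, hxV⟩, ?_⟩
    simp only [c, Equiv.apply_symm_apply, ← hx]
    rw [Set.sdiff_sdiff_cancel_left hsub]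
  have hM : Nat.card {i // c i ∈ H.edgeSet} = t := by
    have h1 : H.edgeSet = c '' {i | c i ∈ H.edgeSet} := by
      ext e
      constructor
      · intro he
        obtain ⟨i, rfl⟩ := hEc e he
        exact ⟨i, he, rfl⟩
      · rintro ⟨i, hi, rfl⟩
        exact hi
    have h2 := hE
    rw [h1, hcinj.encard_image] at h2
    change Nat.card ({i | c i ∈ H.edgeSet} : Set _) = t
    rw [Nat.card_coe_set_eq, Set.ncard, h2]; rfl
  have htle : t ≤ r + 1 := by
    rw [← hM]
    simpa using Finite.card_subtype_le (fun i => c i ∈ H.edgeSet)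
  have hL : Nat.card {i : Fin (r + 1) // (i : ℕ) < t} = t := by
    have := simplexGraph_encard_edgeSet r t htle
    have h1 : (simplexGraph r t).edgeSet =
        (fun i : Fin (r + 1) => ({i}ᶜ : Set (Fin (r + 1)))) '' {i | (i : ℕ) < t} := by
      ext e; simp [simplexGraph, eq_comm]
    rw [h1, Function.Injective.encard_image (by intro i j hij; simpa using hij)] at this
    change Nat.card ({i | (i : ℕ) < t} : Set (Fin (r + 1))) = t
    rw [Nat.card_coe_set_eq, Set.ncard, this]; rfl
  let e1 : {i : Fin (r + 1) // (i : ℕ) < t} ≃ {i // c i ∈ H.edgeSet} :=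
    (Finite.equivFinOfCardEq hL).trans (Finite.equivFinOfCardEq hM).symm
  let σ : Equiv.Perm (Fin (r + 1)) := e1.extendSubtype
  have hσ : ∀ i, c (σ i) ∈ H.edgeSet ↔ (i : ℕ) < t := fun i =>
    ⟨fun h => by
      by_contra hi
      exact e1.extendSubtype_not_mem i hi h, fun h => e1.extendSubtype_mem i h⟩
  let φ : Fin (r + 1) → α := fun i => (e0 (σ i) : α)
  have hφ : Function.Injective φ :=
    Subtype.val_injective.comp (e0.injective.comp σ.injective)
  have hrange : Set.range φ = H.vertexSet := by
    ext x
    constructor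
    · rintro ⟨i, rfl⟩
      exact (e0 (σ i)).2
    · intro hx
      exact ⟨σ.symm (e0.symm ⟨x, hx⟩), by simp [φ]⟩
  have himg : ∀ i, φ '' {i}ᶜ = c (σ i) := by
    intro i
    rw [Set.image_compl_eq_range_sdiff_image hφ, hrange, Set.image_singleton]
  refine ⟨φ, hφ, Hypergraph.ext ?_ ?_⟩
  · simp [simplexGraph, hrange]
  · ext e
    constructor
    · rintro ⟨_, ⟨i, hi, rfl⟩, rfl⟩
      rw [himg]
      exact (hσ i).2 hi
    · intro he
      obtain ⟨i, rfl⟩ := hEc e he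
      refine ⟨{σ.symm i}ᶜ, ⟨σ.symm i, (hσ _).1 (by simpa using he), rfl⟩, ?_⟩
      rw [himg]; simp

/-! A random construction gives the bound. Colour the (r - 1)-subsets of `Fin n` with two colours at
random, put k = r + 2 - t, and take as edges the r-sets whose facets obtained by deleting the first
k vertices alternate in colour.

Each pair of facets of an (r + 1)-set shares one (r - 1)-set. If both facets are edges, the colour
of that set ties together the parities of the two deleted ranks. Hence no (r + 1)-set spans more
than r + 2 - k = t edges (`card_alternating_facets_le`), whatever the colouring. A suitable pattern
on the (r - 1)-subsets attains t (`le_card_alternating_facets`).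

It remains to find this pattern in every m-set. An m-set contains about m^(r-1) many (r + 1)-sets
sharing no (r - 1)-set (`exists_packing`), on which the pattern appears independently, so all fail
with probability at most exp(-c m^(r-1)). A union bound over at most n^m sets succeeds once m^(r-2)
exceeds a constant times log n (`exists_coloring`). -/

/-! ### Packings and random colourings. -/

open Finset in
/-- Among the two-colourings of `ι`, the proportion of those that differ from a prescribed pattern
on each of a family of pairwise disjoint blocks of size `N` is at most `(1 - 2⁻ᴺ)` to the number
of blocks. -/
theorem card_colorings_avoiding_le {ι τ : Type*} [Fintype ι] [DecidableEq ι] [DecidableEq τ]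
    (N : ℕ) (B : τ → Finset ι) (g : τ → ι → Bool) (F : Finset τ)
    (hB : ∀ T ∈ F, #(B T) = N) (hd : (F : Set τ).PairwiseDisjoint B) :
    (#{χ : ι → Bool | ∀ T ∈ F, ¬ ∀ i ∈ B T, χ i = g T i} : ℝ) ≤
      (1 - (1 / 2) ^ N) ^ #F * 2 ^ Fintype.card ι := by
  induction F using Finset.induction_on with
  | empty => simp
  | insert T F hT ih =>
    have ih := ih (fun U hU => hB U (mem_insert_of_mem hU))
      (hd.subset (by simp))
    set S : Finset (ι → Bool) := {χ | ∀ T ∈ F, ¬ ∀ i ∈ B T, χ i = g T i} with hS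
    have hsplit : ({χ : ι → Bool | ∀ U ∈ insert T F, ¬ ∀ i ∈ B U, χ i = g U i} : Finset _) =
        S.filter (fun χ => ¬ ∀ i ∈ B T, χ i = g T i) := by
      ext χ
      simp only [hS, mem_filter, mem_univ, true_and, forall_mem_insert, and_comm]
    have hadd := card_filter_add_card_filter_not (s := S) (fun χ => ∀ i ∈ B T, χ i = g T i)
    -- Overwriting `χ` by `g T` on `B T` keeps it in `S`, since the other blocks are disjoint from
    -- `B T`. At most `2 ^ N` colourings have the same result, as they differ only on `B T`.
    have hfib : #S ≤ 2 ^ N * #(S.filter (fun χ => ∀ i ∈ B T, χ i = g T i)) := by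
      refine card_le_mul_card_image_of_maps_to
        (f := fun χ i => if i ∈ B T then g T i else χ i) ?_ _ ?_
      · intro χ hχ
        simp only [hS, mem_filter, mem_univ, true_and] at hχ ⊢
        refine ⟨fun U hU hall => hχ U hU fun i hi => ?_, fun i hi => by simp [hi]⟩
        have hdis : Disjoint (B U) (B T) :=
          hd (by simp [hU]) (by simp) (fun h => hT (h ▸ hU))
        have := hall i hi
        rwa [if_neg (Finset.disjoint_left.1 hdis hi)] at this
      · intro ψ _
        have hcard : #(Fintype.piFinset fun i : ι => if i ∈ B T then (univ : Finset Bool) else {ψ i})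
            = 2 ^ N := by
          rw [Fintype.card_piFinset, ← hB T (by simp)]
          simp only [apply_ite card, card_univ, Fintype.card_bool, card_singleton]
          rw [prod_ite_mem]
          simp
        rw [← hcard]
        refine card_le_card fun χ hχ => ?_
        simp only [mem_filter] at hχ
        rw [Fintype.mem_piFinset]
        intro i
        by_cases hi : i ∈ B T
        · simp [hi]
        · have := congrFun hχ.2 i
          simp only [hi, if_false] at this
          simp [hi, this]
    rw [hsplit, card_insert_of_notMem hT]
    have h1 : (#S : ℝ) ≤ 2 ^ N * #(S.filter (fun χ => ∀ i ∈ B T, χ i = g T i)) := by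
      exact_mod_cast hfib
    have h2 : (#(S.filter (fun χ => ∀ i ∈ B T, χ i = g T i)) : ℝ) +
      #(S.filter (fun χ => ¬ ∀ i ∈ B T, χ i = g T i)) = #S := by exact_mod_cast hadd
    have h3 : (1 / 2 : ℝ) ^ N * #S ≤ #(S.filter (fun χ => ∀ i ∈ B T, χ i = g T i)) := by
      calc (1 / 2 : ℝ) ^ N * #S
          ≤ (1 / 2 : ℝ) ^ N * (2 ^ N * #(S.filter (fun χ => ∀ i ∈ B T, χ i = g T i))) := by
            gcongr
        _ = _ := by rw [← mul_assoc, ← mul_pow]; norm_num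
    have h4 : (0 : ℝ) ≤ 1 - (1 / 2) ^ N := by
      have : (1 / 2 : ℝ) ^ N ≤ 1 := pow_le_one₀ (by norm_num) (by norm_num)
      linarith
    calc (#(S.filter (fun χ => ¬ ∀ i ∈ B T, χ i = g T i)) : ℝ)
        ≤ (1 - (1 / 2) ^ N) * #S := by linarith
      _ ≤ (1 - (1 / 2) ^ N) * ((1 - (1 / 2) ^ N) ^ #F * 2 ^ Fintype.card ι) := by gcongr
      _ = _ := by ring

open Finset in
/-- A partial Steiner system: a maximal family of `(r + 1)`-subsets of an `m`-set, no two of which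
share an `(r - 1)`-subset, has order of magnitude `m ^ (r - 1)`. -/
theorem exists_packing {α : Type*} [DecidableEq α] (r : ℕ) (hr : 1 ≤ r) (W : Finset α)
    (hW : 2 * r ≤ #W) :
    ∃ F : Finset (Finset α), F ⊆ powersetCard (r + 1) W ∧
      (F : Set (Finset α)).PairwiseDisjoint (powersetCard (r - 1)) ∧
      #W ^ (r - 1) ≤ 2 ^ (r + 1) * (r + 1).factorial * (r + 1).choose (r - 1) * #F := by
  classical
  obtain ⟨F, hF⟩ := Finset.exists_maximal
    (s := (powersetCard (r + 1) W).powerset.filter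
      (fun F : Finset (Finset α) => (F : Set (Finset α)).PairwiseDisjoint (powersetCard (r - 1))))
    ⟨∅, by simp⟩
  have hF1 := hF.prop
  simp only [mem_filter, mem_powerset] at hF1
  refine ⟨F, hF1.1, hF1.2, ?_⟩
  set D := F.biUnion (powersetCard (r - 1)) with hD
  have hDcard : #D ≤ #F * (r + 1).choose (r - 1) := by
    refine card_biUnion_le_card_mul _ _ _ fun T hT => ?_
    rw [card_powersetCard, (mem_powersetCard.1 (hF1.1 hT)).2]
  -- Otherwise `T` could be added to `F`; by maximality it is already in `F`, and then its own (r -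
  -- 1)-subsets lie in `D`.
  have hmeet : ∀ T ∈ powersetCard (r + 1) W, ∃ S ∈ D, S ⊆ T ∧ #S = r - 1 := by
    intro T hT
    by_contra hcon
    push Not at hcon
    have hdis : ∀ U ∈ F, Disjoint (powersetCard (r - 1) T) (powersetCard (r - 1) U) := by
      intro U hU
      rw [Finset.disjoint_left]
      intro S hS hSU
      have := mem_powersetCard.1 hS
      exact hcon S (mem_biUnion.2 ⟨U, hU, hSU⟩) this.1 this.2
    have hmem : insert T F ∈ (powersetCard (r + 1) W).powerset.filter
      (fun F : Finset (Finset α) => (F : Set (Finset α)).PairwiseDisjoint (powersetCard (r - 1))) := by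
      simp only [mem_filter, mem_powerset]
      refine ⟨insert_subset hT hF1.1, ?_⟩
      rw [coe_insert]
      exact hF1.2.insert fun U hU _ => hdis U hU
    have hTF : T ∈ F := hF.le_of_ge hmem (subset_insert T F) (mem_insert_self T F)
    obtain ⟨S, hS, hSc⟩ := exists_subset_card_eq
      (show r - 1 ≤ #T by rw [(mem_powersetCard.1 hT).2]; omega)
    exact hcon S (mem_biUnion.2 ⟨T, hTF, mem_powersetCard.2 ⟨hS, hSc⟩⟩) hS hSc
  -- Each (r + 1)-set is a member of `D` plus two points, which bounds `(#W).choose (r + 1)` by `#D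
  -- * #W ^ 2`.
  have hcover : powersetCard (r + 1) W ⊆
      (D ×ˢ (W ×ˢ W)).image (fun p => p.1 ∪ {p.2.1, p.2.2}) := by
    intro T hT
    obtain ⟨S, hS, hST, hSc⟩ := hmeet T hT
    obtain ⟨hTW, hTc⟩ := mem_powersetCard.1 hT
    have h2 : #(T \ S) = 2 := by rw [card_sdiff_of_subset hST]; omega
    obtain ⟨a, b, -, hab⟩ := card_eq_two.1 h2
    have ha : a ∈ T \ S := by simp [hab]
    have hb : b ∈ T \ S := by simp [hab]
    refine mem_image.2 ⟨(S, a, b), ?_, ?_⟩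
    · simp [hS, hTW (mem_sdiff.1 ha).1, hTW (mem_sdiff.1 hb).1]
    · simp only
      rw [← hab, union_sdiff_of_subset hST]
  have hchoose : (#W).choose (r + 1) ≤ #F * (r + 1).choose (r - 1) * (#W * #W) := by
    rw [← card_powersetCard]
    refine (card_le_card hcover).trans (card_image_le.trans ?_)
    rw [card_product, card_product]
    gcongr
  have hpow : (#W + 1 - (r + 1)) ^ (r + 1) ≤ (r + 1).factorial * (#W).choose (r + 1) := by
    rw [← Nat.descFactorial_eq_factorial_mul_choose]
    exact Nat.pow_sub_le_descFactorial _ _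
  have hhalf : #W ≤ 2 * (#W + 1 - (r + 1)) := by omega
  have hfin : #W ^ (r - 1) * (#W * #W) ≤
      (2 ^ (r + 1) * (r + 1).factorial * (r + 1).choose (r - 1) * #F) * (#W * #W) := by
    calc #W ^ (r - 1) * (#W * #W) = #W ^ (r + 1) := by
          obtain ⟨s, rfl⟩ : ∃ s, r = s + 1 := ⟨r - 1, by omega⟩
          simp only [Nat.add_sub_cancel]; ring
      _ ≤ (2 * (#W + 1 - (r + 1))) ^ (r + 1) := by gcongr
      _ = 2 ^ (r + 1) * (#W + 1 - (r + 1)) ^ (r + 1) := by rw [mul_pow]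
      _ ≤ 2 ^ (r + 1) * ((r + 1).factorial * (#F * (r + 1).choose (r - 1) * (#W * #W))) := by
          gcongr
          exact hpow.trans (by gcongr)
      _ = _ := by ring
  have hWpos : 0 < #W := by omega
  exact Nat.le_of_mul_le_mul_right hfin (by positivity)

open Finset in
/-- If `m` is large compared to `(log n) ^ (1 / (r - 2))`, then some two-colouring of the finite
subsets of `Fin n` agrees, inside every `m`-set, with the given pattern on all `(r - 1)`-subsets of
some `(r + 1)`-set. -/
theorem exists_coloring (r n m : ℕ) (hr : 2 ≤ r) (g : Finset (Fin n) → Finset (Fin n) → Bool)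
    (hm : 2 * r ≤ m)
    (hlog : (2 ^ (r + 1) * (r + 1).factorial * (r + 1).choose (r - 1) : ℕ) *
      2 ^ ((r + 1).choose (r - 1)) * Real.log n < (m : ℝ) ^ (r - 2)) :
    ∃ χ : Finset (Fin n) → Bool, ∀ W : Finset (Fin n), #W = m →
      ∃ T ⊆ W, #T = r + 1 ∧ ∀ S ∈ powersetCard (r - 1) T, χ S = g T S := by
  set N := (r + 1).choose (r - 1) with hN
  set D := 2 ^ (r + 1) * (r + 1).factorial * N with hD
  have hNpos : 0 < N := Nat.choose_pos (by omega)
  have hDpos : 0 < D := by positivity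
  have hm0 : 0 < m := by omega
  have hbound : ∀ W : Finset (Fin n), #W = m →
      (#{χ : Finset (Fin n) → Bool | ¬ ∃ T ⊆ W, #T = r + 1 ∧
        ∀ S ∈ powersetCard (r - 1) T, χ S = g T S} : ℝ) ≤
      Real.exp (-((1 / 2) ^ N * ((m : ℝ) ^ (r - 1) / D))) *
        2 ^ Fintype.card (Finset (Fin n)) := by
    intro W hW
    obtain ⟨F, hFW, hFd, hFc⟩ := exists_packing r (by omega) W (by omega)
    have h1 := card_colorings_avoiding_le N (powersetCard (r - 1)) g F
      (fun T hT => by rw [card_powersetCard, (mem_powersetCard.1 (hFW hT)).2]) hFd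
    have h2 : #{χ : Finset (Fin n) → Bool | ¬ ∃ T ⊆ W, #T = r + 1 ∧
        ∀ S ∈ powersetCard (r - 1) T, χ S = g T S} ≤
        #{χ : Finset (Fin n) → Bool | ∀ T ∈ F, ¬ ∀ S ∈ powersetCard (r - 1) T, χ S = g T S} := by
      refine card_le_card fun χ hχ => ?_
      simp only [mem_filter, mem_univ, true_and] at hχ ⊢
      intro T hT hall
      obtain ⟨hTW, hTc⟩ := mem_powersetCard.1 (hFW hT)
      exact hχ ⟨T, hTW, hTc, hall⟩
    refine (Nat.cast_le.2 h2).trans ((le_of_eq_of_le (by congr!) h1).trans ?_)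
    gcongr
    have h3 : (m : ℝ) ^ (r - 1) / D ≤ #F := by
      rw [div_le_iff₀ (by positivity), mul_comm]
      rw [hW] at hFc
      exact_mod_cast hFc
    calc (1 - (1 / 2 : ℝ) ^ N) ^ #F ≤ (Real.exp (-(1 / 2 : ℝ) ^ N)) ^ #F := by
          gcongr
          · have : (1 / 2 : ℝ) ^ N ≤ 1 := pow_le_one₀ (by norm_num) (by norm_num)
            linarith
          · have := Real.add_one_le_exp (-(1 / 2 : ℝ) ^ N)
            linarith
      _ = Real.exp (-((1 / 2) ^ N * #F)) := by
          rw [← Real.exp_nat_mul]; ring_nf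
      _ ≤ _ := by gcongr
  by_contra hcon
  push Not at hcon
  -- The case `n = 0` is separate because `n ^ m` is later written as `exp (m * log n)`.
  rcases Nat.eq_zero_or_pos n with rfl | hn
  · obtain ⟨W, hW, -⟩ := hcon fun _ => true
    have := W.card_le_univ
    rw [hW, Fintype.card_fin] at this
    omega
  have hcover : (univ : Finset (Finset (Fin n) → Bool)) ⊆ (powersetCard m univ).biUnion
      fun W => {χ : Finset (Fin n) → Bool | ¬ ∃ T ⊆ W, #T = r + 1 ∧
        ∀ S ∈ powersetCard (r - 1) T, χ S = g T S} := by
    intro χ _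
    obtain ⟨W, hW, h⟩ := hcon χ
    refine mem_biUnion.2 ⟨W, mem_powersetCard.2 ⟨subset_univ _, hW⟩, ?_⟩
    simp only [mem_filter, mem_univ, true_and]
    rintro ⟨T, hT, hTc, hall⟩
    obtain ⟨S, hS, hne⟩ := h T hT hTc
    exact hne (hall S hS)
  have hle := (card_le_card hcover).trans card_biUnion_le
  have hcount : (2 : ℝ) ^ Fintype.card (Finset (Fin n)) ≤
      (n : ℝ) ^ m * (Real.exp (-((1 / 2) ^ N * ((m : ℝ) ^ (r - 1) / D))) *
        2 ^ Fintype.card (Finset (Fin n))) := by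
    have h1 : (2 : ℝ) ^ Fintype.card (Finset (Fin n)) =
        (#(univ : Finset (Finset (Fin n) → Bool)) : ℝ) := by
      rw [card_univ, Fintype.card_fun, Fintype.card_bool]; push_cast; rfl
    have h2 : (#(powersetCard m (univ : Finset (Fin n))) : ℝ) ≤ (n : ℝ) ^ m := by
      rw [card_powersetCard, card_univ, Fintype.card_fin]
      exact_mod_cast Nat.choose_le_pow n m
    calc (2 : ℝ) ^ Fintype.card (Finset (Fin n)) ≤ _ := h1.le.trans (Nat.cast_le.2 hle)
      _ ≤ _ := by
        rw [Nat.cast_sum]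
        refine (sum_le_card_nsmul _ _ _ fun W hW =>
          hbound W (mem_powersetCard.1 hW).2).trans ?_
        rw [nsmul_eq_mul]
        gcongr
  have hexp : (n : ℝ) ^ m = Real.exp (m * Real.log n) := by
    rw [Real.exp_nat_mul, Real.exp_log (by exact_mod_cast hn)]
  rw [hexp, ← mul_assoc, ← Real.exp_add] at hcount
  -- One factor `m` cancels between the number of `m`-sets and the failure exponent; this is why
  -- `hlog` involves the power `r - 2`.
  have hone : Real.exp (m * Real.log n + -((1 / 2) ^ N * ((m : ℝ) ^ (r - 1) / D))) < 1 := by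
    rw [Real.exp_lt_one_iff]
    have h3 : (m : ℝ) ^ (r - 1) = m * (m : ℝ) ^ (r - 2) := by
      rw [← pow_succ', show r - 2 + 1 = r - 1 by omega]
    have h4 : Real.log n < (1 / 2) ^ N * ((m : ℝ) ^ (r - 2) / D) := by
      rw [one_div, inv_pow, ← div_eq_inv_mul, div_div, lt_div_iff₀ (by positivity)]
      linarith
    have h5 : (m : ℝ) * Real.log n < m * ((1 / 2) ^ N * ((m : ℝ) ^ (r - 2) / D)) := by
      gcongr
    rw [h3]
    have h6 : (1 / 2 : ℝ) ^ N * (m * (m : ℝ) ^ (r - 2) / D) =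
      m * ((1 / 2) ^ N * ((m : ℝ) ^ (r - 2) / D)) := by ring
    linarith
  have hpos : (0 : ℝ) < 2 ^ Fintype.card (Finset (Fin n)) := by positivity
  nlinarith

/-! ### Alternating sets and the count of alternating facets. -/

namespace Finset

variable {α : Type*} [LinearOrder α]

/-- The number of elements of `T` below `v`. -/
def rank (T : Finset α) (v : α) : ℕ := #{x ∈ T | x < v}

theorem rank_lt_rank {T : Finset α} {u v : α} (hu : u ∈ T) (huv : u < v) :
    T.rank u < T.rank v := by
  refine card_lt_card ⟨fun x hx => ?_, fun h => ?_⟩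
  · simp only [mem_filter] at hx ⊢
    exact ⟨hx.1, hx.2.trans huv⟩
  · have := h (mem_filter.2 ⟨hu, huv⟩)
    simp at this

theorem rank_lt_card {T : Finset α} {v : α} (hv : v ∈ T) : T.rank v < #T := by
  refine card_lt_card ⟨filter_subset _ _, fun h => ?_⟩
  have := h hv
  simp at this

theorem rank_injOn (T : Finset α) : Set.InjOn T.rank T := by
  intro u hu v hv h
  rcases lt_trichotomy u v with h1 | h1 | h1
  · exact absurd h (rank_lt_rank hu h1).ne
  · exact h1
  · exact absurd h (rank_lt_rank hv h1).ne'

theorem rank_erase_of_le {T : Finset α} {u v : α} (h : u ≤ v) : (T.erase v).rank u = T.rank u := by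
  unfold rank
  congr 1
  ext x
  simp only [mem_filter, mem_erase]
  exact ⟨fun hx => ⟨hx.1.2, hx.2⟩, fun hx => ⟨⟨(hx.2.trans_le h).ne, hx.1⟩, hx.2⟩⟩

theorem rank_erase_of_lt {T : Finset α} {u v : α} (hv : v ∈ T) (h : v < u) :
    (T.erase v).rank u + 1 = T.rank u := by
  unfold rank
  rw [filter_erase, card_erase_add_one (by simp [hv, h])]

/-- A finite set is `k`-alternating for `χ` if removing its elements of rank `0, 1, …, k - 1`
gives sets of alternating colours. -/
def IsAlternating (χ : Finset α → Bool) (k : ℕ) (e : Finset α) : Prop :=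
  ∀ v ∈ e, e.rank v < k → χ (e.erase v) = decide (Even (e.rank v))

instance (χ : Finset α → Bool) (k : ℕ) (e : Finset α) : Decidable (IsAlternating χ k e) := by
  unfold IsAlternating; infer_instance

/-- The colouring of the subsets of `T` that makes many facets of `T` alternating: it is
determined by the rank of the first element of the complement. -/
def alternatingPattern (T S : Finset α) : Bool :=
  decide (Even #{x ∈ T | ∀ y ∈ T \ S, x < y})

theorem alternatingPattern_erase_erase {T : Finset α} {u v : α} (hu : u ∈ T)
    (huv : u < v) : alternatingPattern T ((T.erase u).erase v) = decide (Even (T.rank u)) := by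
  unfold alternatingPattern rank
  have : {x ∈ T | ∀ y ∈ T \ (T.erase u).erase v, x < y} = {x ∈ T | x < u} := by
    refine filter_congr fun x hx => ⟨fun h => h u (by simp [hu]), fun h y hy => ?_⟩
    simp only [mem_sdiff, mem_erase, not_and] at hy
    by_cases h1 : y = v
    · exact h1 ▸ h.trans huv
    · by_cases h2 : y = u
      · exact h2 ▸ h
      · exact absurd hy.1 (hy.2 h1 h2)
  rw [this]

/-- Both facets prescribe the colour of `T` minus `u` and `v`. In `T.erase v` the rank of `u` is
unchanged, while in `T.erase u` the rank of `v` drops by one. -/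
theorem IsAlternating.even_rank_iff {χ : Finset α → Bool} {k : ℕ} {T : Finset α} {u v : α}
    (hu : u ∈ T) (hv : v ∈ T) (huv : u < v) (hvk : T.rank v ≤ k)
    (h1 : IsAlternating χ k (T.erase u)) (h2 : IsAlternating χ k (T.erase v)) :
    Even (T.rank u) ↔ ¬ Even (T.rank v) := by
  have hlt := rank_lt_rank hu huv
  have e1 := rank_erase_of_lt hu huv
  have e2 := rank_erase_of_le (T := T) huv.le
  have c1 := h1 v (mem_erase.2 ⟨huv.ne', hv⟩) (by omega)
  have c2 := h2 u (mem_erase.2 ⟨huv.ne, hu⟩) (by omega)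
  rw [erase_right_comm, c1, e2, decide_eq_decide] at c2
  rw [← c2, ← e1, Nat.even_add_one, not_not]

/-- A set of size `r + 1` has at most `r + 2 - k` alternating facets. -/
theorem card_alternating_facets_le {χ : Finset α → Bool} {k r : ℕ} {T : Finset α}
    (hT : #T = r + 1) (hk : k ≤ r) :
    #{v ∈ T | IsAlternating χ k (T.erase v)} ≤ r + 2 - k := by
  set A := {v ∈ T | IsAlternating χ k (T.erase v)} with hA
  -- Three ranks cannot have pairwise opposite parities.
  have hlow : #{v ∈ A | T.rank v ≤ k} ≤ 2 := by
    by_contra hcon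
    obtain ⟨a, ha, b, hb, c, hc, hab, hac, hbc⟩ := two_lt_card.1 (not_le.1 hcon)
    have key : ∀ u ∈ ({v ∈ A | T.rank v ≤ k} : Finset α), ∀ v ∈ ({v ∈ A | T.rank v ≤ k} : Finset α),
        u ≠ v → (Even (T.rank u) ↔ ¬ Even (T.rank v)) := by
      intro u hu v hv huv
      simp only [hA, mem_filter] at hu hv
      rcases lt_or_gt_of_ne huv with h | h
      · exact IsAlternating.even_rank_iff hu.1.1 hv.1.1 h hv.2 hu.1.2 hv.1.2
      · have := IsAlternating.even_rank_iff hv.1.1 hu.1.1 h hu.2 hv.1.2 hu.1.2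
        tauto
    have k1 := key a ha b hb hab
    have k2 := key a ha c hc hac
    have k3 := key b hb c hc hbc
    tauto
  have hhigh : #{v ∈ A | ¬ T.rank v ≤ k} ≤ r - k := by
    rw [← Nat.card_Ioc]
    refine card_le_card_of_injOn T.rank ?_ ((rank_injOn T).mono ?_)
    · intro v hv
      simp only [hA, coe_filter, Set.mem_ofPred_eq, mem_filter] at hv
      have := rank_lt_card hv.1.1
      simp only [coe_Ioc, Set.mem_Ioc]
      omega
    · intro v hv
      simp only [hA, coe_filter, Set.mem_ofPred_eq, mem_filter] at hv
      exact hv.1.1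
  have := card_filter_add_card_filter_not (s := A) (fun v => T.rank v ≤ k)
  omega

/-- A set of size `r + 1` coloured by the alternating pattern has at least `r + 2 - k` alternating
facets. -/
theorem le_card_alternating_facets {χ : Finset α → Bool} {k r : ℕ} {T : Finset α}
    (hT : #T = r + 1) (hk : 1 ≤ k)
    (hχ : ∀ S ∈ powersetCard (r - 1) T, χ S = alternatingPattern T S) :
    r + 2 - k ≤ #{v ∈ T | IsAlternating χ k (T.erase v)} := by
  have hpair : ∀ u ∈ T, ∀ v ∈ T, u < v → χ ((T.erase u).erase v) = decide (Even (T.rank u)) := by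
    intro u hu v hv huv
    rw [hχ, alternatingPattern_erase_erase hu huv]
    refine mem_powersetCard.2 ⟨(erase_subset _ _).trans (erase_subset _ _), ?_⟩
    rw [card_erase_of_mem (mem_erase.2 ⟨huv.ne', hv⟩), card_erase_of_mem hu, hT]
    omega
  have hlow : #{v ∈ T | ¬ k - 1 ≤ T.rank v} ≤ k - 1 := by
    refine (card_le_card_of_injOn (t := range (k - 1)) T.rank ?_
      ((rank_injOn T).mono ?_)).trans_eq (card_range _)
    · intro v hv
      simp only [coe_filter, Set.mem_ofPred_eq] at hv
      simp only [coe_range, Set.mem_Iio]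
      omega
    · intro v hv
      simp only [coe_filter, Set.mem_ofPred_eq] at hv
      exact hv.1
  have hsub : #{v ∈ T | k - 1 ≤ T.rank v} ≤ #{v ∈ T | IsAlternating χ k (T.erase v)} := by
    refine card_le_card fun v hv => ?_
    simp only [mem_filter] at hv ⊢
    refine ⟨hv.1, fun u hu hrk => ?_⟩
    obtain ⟨hne, hu⟩ := mem_erase.1 hu
    rcases lt_or_gt_of_ne hne with h | h
    · rw [rank_erase_of_le h.le, erase_right_comm]
      exact hpair u hu v hv.1 h
    -- Here the rank of `u` in `T.erase v` is below `k` and at least `T.rank v ≥ k - 1`, so it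
    -- equals `T.rank v`, the rank that sets the colour.
    · have e1 := rank_erase_of_lt hv.1 h
      have e2 := rank_lt_rank hv.1 h
      rw [hpair v hv.1 u hu h]
      congr 2
      omega
  have := card_filter_add_card_filter_not (s := T) (fun v => k - 1 ≤ T.rank v)
  omega

end Finset

/-! ### The alternating hypergraph and copies of simplex graphs. -/

namespace Hypergraph

/-- The `r`-graph whose edges are the `k`-alternating `r`-sets. -/
def alternating {α : Type*} [LinearOrder α] (χ : Finset α → Bool) (k r : ℕ) : Hypergraph α where
  vertexSet := Set.univ
  edgeSet := {e | ∃ f : Finset α, f.card = r ∧ Finset.IsAlternating χ k f ∧ e = f}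
  subset_vertexSet_of_mem_edgeSet' := fun _ _ => Set.subset_univ _

theorem alternating_isUniform {α : Type*} [LinearOrder α] (χ : Finset α → Bool) (k r : ℕ) :
    (alternating χ k r).IsUniform r := by
  rintro e ⟨f, hf, -, rfl⟩
  rw [Set.encard_coe_eq_coe_finsetCard, hf]

theorem coe_mem_edgeSet_alternating {α : Type*} [LinearOrder α] {χ : Finset α → Bool} {k r : ℕ}
    {f : Finset α} : (f : Set α) ∈ (alternating χ k r).edgeSet ↔
      f.card = r ∧ Finset.IsAlternating χ k f := by
  constructor
  · rintro ⟨f', h1, h2, h3⟩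
    rw [Finset.coe_inj.1 h3]
    exact ⟨h1, h2⟩
  · rintro ⟨h1, h2⟩
    exact ⟨f, h1, h2, rfl⟩

open Finset in
theorem alternating_isFree {α : Type*} [LinearOrder α] (χ : Finset α → Bool) (r t : ℕ)
    (ht : 2 ≤ t) (htr : t ≤ r) :
    (alternating χ (r + 2 - t) r).IsFree (simplexGraph r (t + 1)) := by
  rintro ⟨φ, hφ⟩
  let ψ : Fin (r + 1) → α := fun i => φ ⟨i, trivial⟩
  have hψ : Function.Injective ψ := fun i j h =>
    congrArg Subtype.val (φ.injective (Subtype.ext h))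
  have hT : #(univ.image ψ) = r + 1 := by rw [card_image_of_injective _ hψ]; simp
  have hsub : (univ.filter fun i : Fin (r + 1) => (i : ℕ) < t + 1).image ψ ⊆
      {v ∈ univ.image ψ | IsAlternating χ (r + 2 - t) ((univ.image ψ).erase v)} := by
    intro v hv
    obtain ⟨i, hi, rfl⟩ := mem_image.1 hv
    refine mem_filter.2 ⟨mem_image_of_mem _ (mem_univ _), ?_⟩
    have he := hφ {i}ᶜ ⟨i, (mem_filter.1 hi).2, rfl⟩
    have heq : {x : α | ∃ v : (simplexGraph r (t + 1)).vertexSet,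
        (v : Fin (r + 1)) ∈ ({i}ᶜ : Set (Fin (r + 1))) ∧ (φ v : α) = x} =
        (((univ.image ψ).erase (ψ i) : Finset α) : Set α) := by
      ext x
      simp only [Set.mem_ofPred_eq, coe_erase, coe_image, coe_univ, Set.image_univ, Set.mem_sdiff,
        Set.mem_range, Set.mem_singleton_iff]
      constructor
      · rintro ⟨v, hv, rfl⟩
        exact ⟨⟨v, rfl⟩, fun h => hv (hψ h)⟩
      · rintro ⟨⟨j, rfl⟩, hne⟩
        exact ⟨⟨j, trivial⟩, fun h => hne (congrArg ψ h), rfl⟩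
    rw [heq, coe_mem_edgeSet_alternating] at he
    exact he.2
  have h1 := card_le_card hsub
  rw [card_image_of_injective _ hψ, Fin.card_filter_val_lt] at h1
  have h2 := card_alternating_facets_le (χ := χ) (k := r + 2 - t) hT (by omega)
  omega

open Finset in
/-- A hypergraph contains `simplexGraph r t` as soon as an `(r + 1)`-set of its vertices has `t`
facets that are edges. -/
theorem contains_simplexGraph {α : Type*} [DecidableEq α] (H : Hypergraph α) (r t : ℕ)
    (T A : Finset α) (hTH : (T : Set α) ⊆ H.vertexSet)
    (hT : #T = r + 1) (hAT : A ⊆ T) (hA : t ≤ #A)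
    (hAe : ∀ v ∈ A, ((T.erase v : Finset α) : Set α) ∈ H.edgeSet) :
    H.Contains (simplexGraph r t) := by
  have htr : t ≤ r + 1 := hT ▸ hA.trans (card_le_card hAT)
  have hle : #(univ.filter fun i : Fin (r + 1) => (i : ℕ) < t) ≤ #A := by
    rw [Fin.card_filter_val_lt]; omega
  have hTne : T.Nonempty := card_pos.1 (by omega)
  have : Nonempty α := ⟨hTne.choose⟩
  obtain ⟨f, hf1, hf2⟩ := (Set.Finite.exists_injOn_of_encard_le
    (s := ((univ.filter fun i : Fin (r + 1) => (i : ℕ) < t : Finset _) : Set (Fin (r + 1))))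
    (t := (A : Set α)) (finite_toSet _)
    (by rw [Set.encard_coe_eq_coe_finsetCard, Set.encard_coe_eq_coe_finsetCard]
        exact_mod_cast hle))
  -- The indices below `t` go into `A`; the remaining ones fill up `T` arbitrarily.
  obtain ⟨g, hg⟩ := Finset.exists_equiv_extend_of_card_eq (α := Fin (r + 1)) (t := T)
    (by simp [hT]) (s := univ.filter fun i : Fin (r + 1) => (i : ℕ) < t) (f := f)
    (by
      intro x hx
      obtain ⟨i, hi, rfl⟩ := mem_image.1 hx
      exact hAT (hf1 hi)) hf2
  refine ⟨⟨fun i => ⟨g i, hTH (g i).2⟩, fun i j h => ?_⟩, ?_⟩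
  · have : (g i : α) = g j := Subtype.mk.inj h
    exact Subtype.ext (g.injective (Subtype.ext this))
  · rintro e ⟨i, hi, rfl⟩
    have hmem : i ∈ univ.filter fun i : Fin (r + 1) => (i : ℕ) < t := by simp [hi]
    have hgA : (g i : α) ∈ A := by rw [hg i hmem]; exact hf1 hmem
    convert hAe _ hgA using 1
    ext x
    simp only [Set.mem_ofPred_eq, coe_erase, Set.mem_sdiff, mem_coe, Set.mem_singleton_iff]
    constructor
    · rintro ⟨v, hv, rfl⟩
      exact ⟨(g v).2, fun h => hv (g.injective (Subtype.ext h))⟩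
    · rintro ⟨hx, hne⟩
      refine ⟨⟨g.symm ⟨x, hx⟩, trivial⟩, fun h => hne ?_,
        congrArg Subtype.val (g.apply_symm_apply ⟨x, hx⟩)⟩
      have h' : g.symm ⟨x, hx⟩ = i := h
      rw [← h']; simp

end Hypergraph

/-! ### The upper bound and its asymptotic form. -/

/-- An upper bound on the Erdős–Rogers function of consecutive simplex graphs, in terms of the
number `m` of vertices in which a random alternating hypergraph has no free part. -/
theorem erdosRogers_simplexGraph_le (r t n m : ℕ) (ht : 2 ≤ t) (htr : t ≤ r)
    (hm : 2 * r ≤ m)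
    (hlog : (2 ^ (r + 1) * (r + 1).factorial * (r + 1).choose (r - 1) : ℕ) *
      2 ^ ((r + 1).choose (r - 1)) * Real.log n < (m : ℝ) ^ (r - 2)) :
    erdosRogers r (simplexGraph r t) (simplexGraph r (t + 1)) n ≤ m := by
  obtain ⟨χ, hχ⟩ := exists_coloring r n m (by omega) Finset.alternatingPattern hm hlog
  refine csSup_le' fun p hp => ?_
  by_contra hpm
  obtain ⟨W, -, hWc, hWfree⟩ := hp (Fin n) (Hypergraph.alternating χ (r + 2 - t) r)
    (Hypergraph.alternating_isUniform _ _ _) (by simp [Hypergraph.alternating])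
    (Hypergraph.alternating_isFree χ r t ht htr)
  lift W to Finset (Fin n) using Set.toFinite W
  rw [Set.encard_coe_eq_coe_finsetCard] at hWc
  have hWc' : W.card = p := by exact_mod_cast hWc
  obtain ⟨W', hW', hW'c⟩ := Finset.exists_subset_card_eq (show m ≤ W.card by omega)
  obtain ⟨T, hTW, hTc, hT⟩ := hχ W' hW'c
  have hTW' : (T : Set (Fin n)) ⊆ W := by exact_mod_cast hTW.trans hW'
  refine hWfree (Hypergraph.contains_simplexGraph _ r t T
    {v ∈ T | Finset.IsAlternating χ (r + 2 - t) (T.erase v)}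
    (fun x hx => ⟨trivial, hTW' hx⟩) hTc (Finset.filter_subset _ _) ?_ ?_)
  · have := Finset.le_card_alternating_facets (χ := χ) (k := r + 2 - t) hTc (by omega) hT
    omega
  · intro v hv
    obtain ⟨hvT, hv⟩ := Finset.mem_filter.1 hv
    refine ⟨Hypergraph.coe_mem_edgeSet_alternating.2 ⟨?_, hv⟩, fun x hx => hTW' ?_⟩
    · rw [Finset.card_erase_of_mem hvT, hTc]; rfl
    · exact Finset.mem_of_mem_erase (Finset.mem_coe.1 hx)

theorem corollary1p8 (r t : ℕ) (hr : 3 ≤ r) (ht : 2 ≤ t) (htr : t ≤ r) :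
    ∃ c : ℝ, ∀ᶠ n : ℕ in Filter.atTop,
      (erdosRogers r (simplexGraph r t) (simplexGraph r (t + 1)) n : ℝ) ≤
        c * Real.log n ^ (1 / ((r : ℝ) - 2)) := by
  -- The added 1 makes the inequality in `hlog` strict and ensures `1 ≤ K`, hence `K ≤ K ^ (r - 2)`.
  set K : ℕ := (2 ^ (r + 1) * (r + 1).factorial * (r + 1).choose (r - 1)) *
      2 ^ ((r + 1).choose (r - 1)) + 1 with hK
  have hd : ((r - 2 : ℕ) : ℝ) = (r : ℝ) - 2 := by
    rw [Nat.cast_sub (by omega)]; norm_num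
  have hdpos : (0 : ℝ) < (r : ℝ) - 2 := by
    rw [← hd]; exact_mod_cast (by omega : 0 < r - 2)
  have htend : Filter.Tendsto (fun n : ℕ => Real.log n ^ (1 / ((r : ℝ) - 2)))
      Filter.atTop Filter.atTop :=
    (tendsto_rpow_atTop (by positivity)).comp
      (Real.tendsto_log_atTop.comp tendsto_natCast_atTop_atTop)
  -- With `m = ⌈K * a⌉₊`, the rounding costs less than 1, which is at most `a` for large `n`.
  refine ⟨K + 1, ?_⟩
  filter_upwards [htend.eventually_ge_atTop (2 * r : ℝ), Filter.eventually_ge_atTop 2] with n h1 h2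
  set a := Real.log n ^ (1 / ((r : ℝ) - 2)) with ha
  have hlogpos : 0 < Real.log n := Real.log_pos (by exact_mod_cast h2)
  have hapow : a ^ (r - 2) = Real.log n := by
    rw [ha, ← Real.rpow_natCast, ← Real.rpow_mul hlogpos.le, hd, one_div_mul_cancel hdpos.ne',
      Real.rpow_one]
  have hr3 : (3 : ℝ) ≤ r := by exact_mod_cast hr
  have ha0 : 0 < a := by linarith
  have hK1 : (1 : ℝ) ≤ K := by exact_mod_cast (by omega : 1 ≤ K)
  have hceil : (K : ℝ) * a ≤ (⌈(K : ℝ) * a⌉₊ : ℕ) := Nat.le_ceil _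
  have hmain := erdosRogers_simplexGraph_le r t n ⌈(K : ℝ) * a⌉₊ ht htr
    (by
      have : ((2 * r : ℕ) : ℝ) ≤ (⌈(K : ℝ) * a⌉₊ : ℕ) := by
        push_cast
        nlinarith
      exact_mod_cast this)
    (by
      calc _ < (K : ℝ) * Real.log n := by
            refine mul_lt_mul_of_pos_right ?_ hlogpos
            rw [hK]; push_cast; linarith
        _ ≤ (K : ℝ) ^ (r - 2) * a ^ (r - 2) := by
            rw [hapow]
            gcongr
            exact le_self_pow₀ hK1 (by omega)
        _ = ((K : ℝ) * a) ^ (r - 2) := (mul_pow _ _ _).symm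
        _ ≤ _ := by gcongr)
  have hlt := Nat.ceil_lt_add_one (show 0 ≤ (K : ℝ) * a by positivity)
  have : (erdosRogers r (simplexGraph r t) (simplexGraph r (t + 1)) n : ℝ) ≤
      (⌈(K : ℝ) * a⌉₊ : ℕ) := by exact_mod_cast hmain
  nlinarith
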